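/- Let $\lambda>0$, $\beta>2$ and $\sigma^2\ge 0$ be constants (base-station intensity, path-loss exponent and noise power). Put $K_\beta=\frac{2\pi}{\beta}\csc\frac{2\pi}{\beta}$ and $w_{x,u,\phi}=\sqrt{x^2+u^2-2xu\cos\phi}$, and for $r,z>0$ and $u\ge0$ let $$J(r,z,u)=2z\int_0^{\pi}\!\int_0^r\frac{x}{z+{w_{x,u,\phi}}^{\beta}}\,dx\,d\phi,\qquad \mu(z,u)=2\pi\lambda\int_0^\infty r\exp\bigl(-\lambda[\pi r^2-J(r,z,u)]\bigr)\,dr .$$ The expected instantaneous downlink data rate at distance $u$ is $$\tau(u)=\int_0^\infty\frac1z\exp\bigl(-\sigma^2z-\pi\lambda K_\beta z^{2/\beta}\bigr)\bigl(\mu(z,u)-1\bigr)\,dz .$$ Suppose that $\sigma^2=0$. Then, for every $u\ge0$, the integrals defining $\mu(z,u)$ (for every $z>0$) and $\tau(u)$ and the integral below converge absolutely, and $$\tau(u)\ \ge\ \frac{\beta}{2}\int_0^\infty\frac{z^{\beta/2-1}}{(1+z)\bigl({K_\beta}^{\beta/2}+z^{\beta/2}\bigr)}\exp\Bigl(-\pi\lambda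 u^2\frac{z}{1+z}\Bigr)\,dz .$$ -/

import Mathlib

open MeasureTheory Set

namespace HandoverSkipping

/-- The constant `K_β = (2π/β) csc(2π/β)`. -/
noncomputable def K (β : ℝ) : ℝ :=
  2 * Real.pi / β * (Real.sin (2 * Real.pi / β))⁻¹

/-- The distance `w_{x,u,φ} = √(x² + u² - 2 x u cos φ)`. -/
noncomputable def w (x u φ : ℝ) : ℝ :=
  Real.sqrt (x ^ 2 + u ^ 2 - 2 * x * u * Real.cos φ)

/-- `J(r,z,u) = 2 z ∫_0^π ∫_0^r x / (z + w_{x,u,φ}^β) dx dφ`. -/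
noncomputable def J (β r z u : ℝ) : ℝ :=
  2 * z * ∫ φ in (0 : ℝ)..Real.pi, ∫ x in (0 : ℝ)..r, x / (z + w x u φ ^ β)

/-- The integrand (as a function of `r`) of the integral defining `μ(z,u)`. -/
noncomputable def muIntegrand (lam β z u r : ℝ) : ℝ :=
  r * Real.exp (-lam * (Real.pi * r ^ 2 - J β r z u))

/-- `μ(z,u) = 2πλ ∫_0^∞ r exp(-λ [π r² - J(r,z,u)]) dr`. -/
noncomputable def mu (lam β z u : ℝ) : ℝ :=
  2 * Real.pi * lam * ∫ r in Ioi (0 : ℝ), muIntegrand lam β z u r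

/-- The integrand (as a function of `z`) of the integral defining `τ(u)`;
`sigmaSq` is the noise power `σ²`. -/
noncomputable def tauIntegrand (lam β sigmaSq u z : ℝ) : ℝ :=
  1 / z * Real.exp (-sigmaSq * z - Real.pi * lam * K β * z ^ (2 / β)) * (mu lam β z u - 1)

/-- The expected instantaneous downlink data rate
`τ(u) = ∫_0^∞ (1/z) exp(-σ² z - π λ K_β z^{2/β}) (μ(z,u) - 1) dz`. -/
noncomputable def tau (lam β sigmaSq u : ℝ) : ℝ :=
  ∫ z in Ioi (0 : ℝ), tauIntegrand lam β sigmaSq u z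

/-- The integrand (as a function of `z`) of the lower bound. -/
noncomputable def lowerIntegrand (lam β u z : ℝ) : ℝ :=
  z ^ (β / 2 - 1) / ((1 + z) * (K β ^ (β / 2) + z ^ (β / 2))) *
    Real.exp (-Real.pi * lam * u ^ 2 * (z / (1 + z)))

end HandoverSkipping

/-! In polar coordinates `J` is the integral of z/(z+|v-u|^β) over the disc |v| < r. Since
2πλr·exp(-πλr²) is a probability density, μ-1 is the mean of exp(λJ)-1 under it. For the lower
bound, replace exp(λJ)-1 by λJ. Integrating out r > |v| turns the radial density into the planar
Gaussian λ·exp(-πλ|v|²), and after recentring τ is at least the double integral of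
λ·exp(-πλ|v+u|²)·exp(-πλK z^(2/β))/(z+|v|^β). For fixed v, put z = |v|^β s: the second factor
becomes exp(-πλa|v|²)/(1+s) with a = K s^(2/β), Gaussian in v. The v-integral is then explicit, and
taking a as the new variable gives exactly the stated integrand.

Convergence of τ rests on two bounds, J ≤ πr² and J ≤ C z^(2/β) with C the total mass of the kernel
at z = 1. A convex combination of them keeps some Gaussian decay in r while making the growth in z
as slow as needed (`excessIntegrand_le`). The comparison is run with nonnegative integrals, so it
also yields convergence of the lower integral. -/

namespace HandoverSkipping

/-! ### The kernel, and `J` as an integral over a disc -/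

/-- The interference kernel `z / (z + ‖v‖ ^ β)` on the plane. -/
noncomputable def kernel (β z : ℝ) (v : ℂ) : ℝ := z / (z + ‖v‖ ^ β)

/-- The interference of the disc of radius `r` around the origin at the point `u`. -/
noncomputable def discIntegral (β r z u : ℝ) : ℝ :=
  ∫ v in Metric.ball (0 : ℂ) r, kernel β z (v - u)

lemma kernel_nonneg {β z : ℝ} (hz : 0 < z) (v : ℂ) : 0 ≤ kernel β z v := by
  unfold kernel; positivity

lemma kernel_le_one {β z : ℝ} (hz : 0 < z) (v : ℂ) : kernel β z v ≤ 1 := by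
  have : 0 ≤ ‖v‖ ^ β := by positivity
  unfold kernel
  rw [div_le_one (by linarith)]
  linarith

lemma continuous_kernel {β z : ℝ} (hβ : 0 < β) (hz : 0 < z) : Continuous (kernel β z) := by
  unfold kernel
  refine continuous_const.div ?_ fun v => ?_
  · exact continuous_const.add (continuous_norm.rpow_const fun _ => Or.inr hβ.le)
  · have : 0 ≤ ‖v‖ ^ β := by positivity
    linarith

lemma norm_polar_sub (x u φ : ℝ) :
    ‖(x : ℂ) * (Real.cos φ + Real.sin φ * Complex.I) - u‖ = w x u φ := by
  rw [Complex.norm_def, w, Complex.normSq_apply]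
  congr 1
  simp [-Complex.ofReal_cos, -Complex.ofReal_sin]
  linear_combination x ^ 2 * Real.sin_sq_add_cos_sq φ

/-- Polar coordinates about the origin; the factor 2 in `J` accounts for the reflection φ ↦ -φ,
under which `w` is invariant. -/
lemma J_eq_discIntegral {β r z : ℝ} (hβ : 0 < β) (hr : 0 < r) (hz : 0 < z) (u : ℝ) :
    J β r z u = discIntegral β r z u := by
  have hpi := Real.pi_pos
  set g : ℝ → ℝ → ℝ := fun φ x => x / (z + w x u φ ^ β) with hg
  have hden : ∀ x φ, 0 < z + w x u φ ^ β := fun x φ => by unfold w; positivity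
  have hgc : Continuous (Function.uncurry g) := by
    refine Continuous.div (by fun_prop) ?_ fun p => (hden _ _).ne'
    refine continuous_const.add (Continuous.rpow_const ?_ fun _ => Or.inr hβ.le)
    unfold w
    fun_prop
  have hGc : Continuous fun φ => ∫ x in (0 : ℝ)..r, g φ x :=
    intervalIntegral.continuous_parametric_intervalIntegral_of_continuous' hgc 0 r
  have heven : ∀ φ, (∫ x in (0 : ℝ)..r, g (-φ) x) = ∫ x in (0 : ℝ)..r, g φ x := by
    intro φ; simp [hg, w]
  have hsym : (∫ φ in -Real.pi..Real.pi, ∫ x in (0 : ℝ)..r, g φ x)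
      = 2 * ∫ φ in (0 : ℝ)..Real.pi, ∫ x in (0 : ℝ)..r, g φ x := by
    rw [← intervalIntegral.integral_add_adjacent_intervals (b := 0)
      (hGc.intervalIntegrable _ _) (hGc.intervalIntegrable _ _)]
    have h := intervalIntegral.integral_comp_neg (a := 0) (b := Real.pi)
      fun φ => ∫ x in (0 : ℝ)..r, g φ x
    simp only [heven, neg_zero] at h
    rw [← h]; ring
  have hlhs : J β r z u = z * ∫ φ in -Real.pi..Real.pi, ∫ x in (0 : ℝ)..r, g φ x := by
    rw [hsym]; unfold J; ring
  rw [hlhs, discIntegral, ← integral_indicator measurableSet_ball,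
    ← Complex.integral_comp_polarCoord_symm, polarCoord_target,
    Measure.volume_eq_prod, ← Measure.prod_restrict]
  have hind : ∀ p ∈ (Ioi (0 : ℝ)) ×ˢ (Ioo (-Real.pi) Real.pi),
      p.1 • (Metric.ball (0 : ℂ) r).indicator (fun v => kernel β z (v - u))
        (Complex.polarCoord.symm p)
      = ((Ioo 0 r) ×ˢ (Ioo (-Real.pi) Real.pi)).indicator (fun p => z * g p.2 p.1) p := by
    rintro ⟨x, φ⟩ ⟨hx, hφ⟩
    simp only [mem_Ioi] at hx
    have hn : ‖Complex.polarCoord.symm (x, φ)‖ = x := by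
      rw [Complex.norm_polarCoord_symm, abs_of_pos hx]
    by_cases hxr : x < r
    · rw [indicator_of_mem (by simpa using hn.trans_lt hxr), indicator_of_mem (by exact ⟨⟨hx, hxr⟩, hφ⟩),
        Complex.polarCoord_symm_apply, kernel, norm_polar_sub]
      simp only [hg, smul_eq_mul]; ring
    · rw [indicator_of_notMem (by rw [mem_ball_zero_iff, hn]; exact hxr),
        indicator_of_notMem (fun h => hxr h.1.2), smul_zero]
  rw [Measure.prod_restrict, setIntegral_congr_fun (measurableSet_Ioi.prod measurableSet_Ioo) hind,
    setIntegral_indicator (measurableSet_Ioo.prod measurableSet_Ioo),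
    inter_eq_self_of_subset_right (prod_mono_left Ioo_subset_Ioi_self)]
  have hint : IntegrableOn (fun p : ℝ × ℝ => z * g p.2 p.1)
      (Ioo 0 r ×ˢ Ioo (-Real.pi) Real.pi) (volume.prod volume) := by
    have hc : Continuous fun p : ℝ × ℝ => z * g p.2 p.1 :=
      continuous_const.mul (hgc.comp continuous_swap)
    rw [← Measure.volume_eq_prod]
    exact (hc.continuousOn.integrableOn_compact (isCompact_Icc.prod isCompact_Icc)).mono_set
      (prod_mono Ioo_subset_Icc_self Ioo_subset_Icc_self)
  have hswap := setIntegral_prod_swap (μ := (volume : Measure ℝ)) (ν := (volume : Measure ℝ))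
    (Ioo 0 r) (Ioo (-Real.pi) Real.pi) (fun p : ℝ × ℝ => z * g p.2 p.1)
  rw [← hswap, setIntegral_prod _ (by simpa [Function.comp_def] using hint.swap)]
  rw [← intervalIntegral.integral_const_mul, intervalIntegral.integral_of_le (by linarith),
    integral_Ioc_eq_integral_Ioo]
  congr 1
  ext φ
  rw [← intervalIntegral.integral_const_mul, intervalIntegral.integral_of_le hr.le,
    integral_Ioc_eq_integral_Ioo]
  rfl

/-! ### Total mass of the kernel and bounds on the disc integral -/

/-- The kernel decays like |v|^(-β), and β exceeds the real dimension 2 of the plane. -/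
lemma integrable_kernel_one {β : ℝ} (hβ : 2 < β) : Integrable (kernel β 1) := by
  have h := integrable_one_add_norm (E := ℂ) (μ := volume) (r := β) (by simpa using hβ)
  refine (h.const_mul (2 ^ β)).mono' (continuous_kernel (by linarith) one_pos).aestronglyMeasurable
    (ae_of_all _ fun v => ?_)
  rw [Real.norm_of_nonneg (kernel_nonneg one_pos v), kernel,
    Real.rpow_neg (by positivity), ← div_eq_mul_inv, div_le_div_iff₀ (by positivity) (by positivity),
    one_mul]
  rcases le_total ‖v‖ 1 with hv | hv
  · calc (1 + ‖v‖) ^ β ≤ 2 ^ β := by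
          apply Real.rpow_le_rpow (by positivity) (by linarith) (by linarith)
      _ ≤ 2 ^ β * (1 + ‖v‖ ^ β) := le_mul_of_one_le_right (by positivity)
          (le_add_of_nonneg_right (by positivity))
  · calc (1 + ‖v‖) ^ β ≤ (2 * ‖v‖) ^ β := by
          apply Real.rpow_le_rpow (by positivity) (by linarith) (by linarith)
      _ = 2 ^ β * ‖v‖ ^ β := Real.mul_rpow (by norm_num) (by positivity)
      _ ≤ 2 ^ β * (1 + ‖v‖ ^ β) := by gcongr; linarith

lemma kernel_scaling {β z : ℝ} (hβ : 0 < β) (hz : 0 < z) (v : ℂ) :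
    kernel β z v = kernel β 1 ((z ^ β⁻¹)⁻¹ • v) := by
  have hR : (z ^ β⁻¹) ^ β = z := by rw [← Real.rpow_mul hz.le, inv_mul_cancel₀ hβ.ne', Real.rpow_one]
  have : 0 ≤ ‖v‖ ^ β := by positivity
  rw [kernel, kernel, norm_smul, norm_inv, Real.norm_of_nonneg (by positivity),
    Real.mul_rpow (by positivity) (by positivity), Real.inv_rpow (by positivity), hR]
  field_simp

lemma integrable_kernel {β z : ℝ} (hβ : 2 < β) (hz : 0 < z) : Integrable (kernel β z) := by
  rw [funext (kernel_scaling (by linarith : 0 < β) hz)]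
  exact (integrable_kernel_one hβ).comp_smul (by positivity)

/-- Dilation by z^(1/β) scales area by z^(2/β), the same power as in the exponential weight of τ. -/
lemma integral_kernel {β z : ℝ} (hβ : 2 < β) (hz : 0 < z) :
    ∫ v, kernel β z v = z ^ (2 / β) * ∫ v, kernel β 1 v := by
  rw [funext (kernel_scaling (by linarith : 0 < β) hz),
    Measure.integral_comp_inv_smul_of_nonneg _ _ (by positivity), Complex.finrank_real_complex,
    smul_eq_mul, ← Real.rpow_natCast, ← Real.rpow_mul hz.le]
  congr 2
  push_cast; ring

lemma integrable_kernel_sub {β z : ℝ} (hβ : 2 < β) (hz : 0 < z) (u : ℂ) :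
    Integrable fun v => kernel β z (v - u) :=
  (integrable_kernel hβ hz).comp_sub_right u

lemma discIntegral_nonneg {β z : ℝ} (hz : 0 < z) (r u : ℝ) : 0 ≤ discIntegral β r z u :=
  integral_nonneg fun _ => kernel_nonneg hz _

lemma discIntegral_le_total {β z : ℝ} (hβ : 2 < β) (hz : 0 < z) (r u : ℝ) :
    discIntegral β r z u ≤ (∫ v, kernel β 1 v) * z ^ (2 / β) := by
  calc discIntegral β r z u ≤ ∫ v : ℂ, kernel β z (v - u) :=
        setIntegral_le_integral (integrable_kernel_sub hβ hz u) (ae_of_all _ fun _ => kernel_nonneg hz _)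
    _ = _ := by rw [integral_sub_right_eq_self (kernel β z), integral_kernel hβ hz, mul_comm]

lemma discIntegral_le_area {β z r : ℝ} (hβ : 2 < β) (hz : 0 < z) (hr : 0 < r) (u : ℝ) :
    discIntegral β r z u ≤ Real.pi * r ^ 2 := by
  have hvol : volume.real (Metric.ball (0 : ℂ) r) = Real.pi * r ^ 2 := by
    rw [Measure.real, Complex.volume_ball]
    simp [ENNReal.toReal_ofReal hr.le, mul_comm]
  calc discIntegral β r z u ≤ ∫ v in Metric.ball (0 : ℂ) r, (1 : ℝ) :=
        setIntegral_mono (integrable_kernel_sub hβ hz u).integrableOn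
          (integrableOn_const (by simp [Complex.volume_ball, ENNReal.mul_eq_top]))
          fun _ => kernel_le_one hz _
    _ = _ := by simp [hvol]

lemma ofReal_discIntegral {β z : ℝ} (hβ : 2 < β) (hz : 0 < z) (r u : ℝ) :
    ENNReal.ofReal (discIntegral β r z u)
      = ∫⁻ v in Metric.ball (0 : ℂ) r, ENNReal.ofReal (kernel β z (v - u)) :=
  ofReal_integral_eq_lintegral_ofReal (integrable_kernel_sub hβ hz u).integrableOn
    (ae_of_all _ fun _ => kernel_nonneg hz _)

lemma measurable_discIntegral (β u : ℝ) :
    Measurable fun p : ℝ × ℝ => discIntegral β p.1 p.2 u := by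
  have h : Measurable fun q : (ℝ × ℝ) × ℂ =>
      {q : (ℝ × ℝ) × ℂ | ‖q.2‖ < q.1.1}.indicator (fun q => kernel β q.1.2 (q.2 - u)) q := by
    refine Measurable.indicator ?_ (measurableSet_lt (by fun_prop) (by fun_prop))
    unfold kernel
    fun_prop
  have h2 := h.stronglyMeasurable.integral_prod_right' (ν := (volume : Measure ℂ))
  convert h2.measurable using 2 with p
  rw [discIntegral, ← integral_indicator measurableSet_ball]
  congr 1
  ext v
  simp [indicator]

/-! ### The radial density and μ - 1 -/

lemma integrableOn_mul_exp_neg_mul_sq {c : ℝ} (hc : 0 < c) (a : ℝ) :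
    IntegrableOn (fun r => 2 * c * r * Real.exp (-c * r ^ 2)) (Ioi a) := by
  simpa [mul_assoc] using ((integrable_mul_exp_neg_mul_sq hc).const_mul (2 * c)).integrableOn

lemma integral_Ioi_mul_exp_neg_mul_sq {c : ℝ} (hc : 0 < c) (a : ℝ) :
    ∫ r in Ioi a, 2 * c * r * Real.exp (-c * r ^ 2) = Real.exp (-c * a ^ 2) := by
  have hd : ∀ x ∈ Ici a, HasDerivAt (fun r => -Real.exp (-c * r ^ 2))
      (2 * c * x * Real.exp (-c * x ^ 2)) x := by
    intro x _
    have := (((hasDerivAt_pow 2 x).const_mul (-c)).exp).neg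
    refine this.congr_deriv ?_
    push_cast; ring
  have ht : Filter.Tendsto (fun r : ℝ => -Real.exp (-c * r ^ 2)) Filter.atTop (nhds 0) := by
    have h1 : Filter.Tendsto (fun r : ℝ => -c * r ^ 2) Filter.atTop Filter.atBot :=
      (Filter.tendsto_pow_atTop two_ne_zero).const_mul_atTop_of_neg (by linarith)
    simpa using (Real.tendsto_exp_atBot.comp h1).neg
  rw [integral_Ioi_of_hasDerivAt_of_tendsto' hd (integrableOn_mul_exp_neg_mul_sq hc a) ht]
  ring

lemma lintegral_Ioi_mul_exp_neg_mul_sq {c a : ℝ} (hc : 0 < c) (ha : 0 ≤ a) :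
    ∫⁻ r in Ioi a, ENNReal.ofReal (2 * c * r * Real.exp (-c * r ^ 2))
      = ENNReal.ofReal (Real.exp (-c * a ^ 2)) := by
  rw [← integral_Ioi_mul_exp_neg_mul_sq hc a,
    ofReal_integral_eq_lintegral_ofReal (integrableOn_mul_exp_neg_mul_sq hc a)]
  filter_upwards [ae_restrict_mem measurableSet_Ioi] with r hr
  have : 0 < r := ha.trans_lt hr
  simp only [Pi.zero_apply]; positivity

/-- The Rayleigh density times `exp (λ J) - 1`: the integrand of `μ(z,u) - 1`. -/
noncomputable def excessIntegrand (lam β z u r : ℝ) : ℝ :=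
  2 * (Real.pi * lam) * r * Real.exp (-(Real.pi * lam) * r ^ 2) *
    (Real.exp (lam * discIntegral β r z u) - 1)

lemma measurable_excessIntegrand (lam β u : ℝ) :
    Measurable fun p : ℝ × ℝ => excessIntegrand lam β p.1 u p.2 := by
  have h : Measurable fun p : ℝ × ℝ => discIntegral β p.2 p.1 u :=
    (measurable_discIntegral β u).comp measurable_swap
  unfold excessIntegrand
  fun_prop

lemma muIntegrand_eq {lam β z u r : ℝ} (hlam : lam ≠ 0) (hβ : 0 < β) (hz : 0 < z) (hr : 0 < r) :
    muIntegrand lam β z u r = (2 * (Real.pi * lam))⁻¹ *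
      (excessIntegrand lam β z u r
        + 2 * (Real.pi * lam) * r * Real.exp (-(Real.pi * lam) * r ^ 2)) := by
  have hpi := Real.pi_pos.ne'
  rw [muIntegrand, excessIntegrand, J_eq_discIntegral hβ hr hz,
    show -lam * (Real.pi * r ^ 2 - discIntegral β r z u)
      = -(Real.pi * lam) * r ^ 2 + lam * discIntegral β r z u by ring, Real.exp_add]
  field_simp
  ring

lemma excessIntegrand_nonneg {lam β z u r : ℝ} (hlam : 0 < lam) (hz : 0 < z) (hr : 0 < r) :
    0 ≤ excessIntegrand lam β z u r := by
  have := Real.pi_pos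
  have h : 1 ≤ Real.exp (lam * discIntegral β r z u) :=
    Real.one_le_exp (mul_nonneg hlam.le (discIntegral_nonneg hz r u))
  exact mul_nonneg (by positivity) (by linarith)

lemma le_excessIntegrand {lam β z u r : ℝ} (hlam : 0 < lam) (hr : 0 < r) :
    2 * (Real.pi * lam) * r * Real.exp (-(Real.pi * lam) * r ^ 2) *
      (lam * discIntegral β r z u) ≤ excessIntegrand lam β z u r := by
  have := Real.pi_pos
  refine mul_le_mul_of_nonneg_left ?_ (by positivity)
  linarith [Real.add_one_le_exp (lam * discIntegral β r z u)]

/-- This is 1 - x ≤ exp(-x) multiplied by exp x. The factor x later supplies the z^(2/β) that tames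
1/z at the origin. -/
lemma exp_sub_one_le (x : ℝ) : Real.exp x - 1 ≤ x * Real.exp x := by
  have h := mul_le_mul_of_nonneg_left (Real.one_sub_le_exp_neg x) (Real.exp_pos x).le
  rw [← Real.exp_add, add_neg_cancel, Real.exp_zero] at h
  linarith

/-- Interpolating between the two bounds on `J` trades the Gaussian weight for growth in `z`. -/
lemma excessIntegrand_le {lam β z u r θ : ℝ} (hlam : 0 < lam) (hβ : 2 < β) (hz : 0 < z)
    (hr : 0 < r) (hθ : 0 < θ) (hθ1 : θ ≤ 1) :
    excessIntegrand lam β z u r ≤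
      lam * ((∫ v, kernel β 1 v) * z ^ (2 / β)) / θ *
        Real.exp (lam * θ * ((∫ v, kernel β 1 v) * z ^ (2 / β))) *
        (2 * (Real.pi * lam * θ) * r * Real.exp (-(Real.pi * lam * θ) * r ^ 2)) := by
  have hpi := Real.pi_pos
  set T := (∫ v, kernel β 1 v) * z ^ (2 / β)
  set D := discIntegral β r z u with hD
  have hD0 : 0 ≤ D := discIntegral_nonneg hz r u
  have hDT : D ≤ T := discIntegral_le_total hβ hz r u
  have hDr : D ≤ Real.pi * r ^ 2 := discIntegral_le_area hβ hz hr u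
  have h1 : D ≤ (1 - θ) * (Real.pi * r ^ 2) + θ * T := by nlinarith
  have h2 : Real.exp (lam * D) - 1 ≤
      lam * T * Real.exp (lam * ((1 - θ) * (Real.pi * r ^ 2) + θ * T)) :=
    have hT : 0 ≤ lam * T := mul_nonneg hlam.le (hD0.trans hDT)
    (exp_sub_one_le _).trans (by gcongr)
  calc excessIntegrand lam β z u r ≤ 2 * (Real.pi * lam) * r * Real.exp (-(Real.pi * lam) * r ^ 2) *
        (lam * T * Real.exp (lam * ((1 - θ) * (Real.pi * r ^ 2) + θ * T))) :=
        mul_le_mul_of_nonneg_left h2 (by positivity)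
    _ = _ := by
        have : Real.exp (-(Real.pi * lam) * r ^ 2) *
            Real.exp (lam * ((1 - θ) * (Real.pi * r ^ 2) + θ * T))
            = Real.exp (lam * θ * T) * Real.exp (-(Real.pi * lam * θ) * r ^ 2) := by
          rw [← Real.exp_add, ← Real.exp_add]; ring_nf
        rw [show ∀ X Y : ℝ, lam * T / θ * X * (2 * (Real.pi * lam * θ) * r * Y)
          = 2 * (Real.pi * lam) * r * (lam * T) * (X * Y) from fun X Y => by field_simp, ← this]
        ring

lemma integrableOn_excessIntegrand {lam β z : ℝ} (hlam : 0 < lam) (hβ : 2 < β) (hz : 0 < z)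
    (u : ℝ) : IntegrableOn (excessIntegrand lam β z u) (Ioi 0) := by
  have hpi := Real.pi_pos
  -- With z fixed, any θ in (0, 1] would serve; 1/2 is arbitrary.
  refine Integrable.mono'
    ((integrableOn_mul_exp_neg_mul_sq (by positivity : 0 < Real.pi * lam * (1 / 2)) 0).const_mul
      (lam * ((∫ v, kernel β 1 v) * z ^ (2 / β)) / (1 / 2) *
        Real.exp (lam * (1 / 2) * ((∫ v, kernel β 1 v) * z ^ (2 / β)))))
    ((measurable_excessIntegrand lam β u).comp
      (measurable_prodMk_left (x := z))).aestronglyMeasurable ?_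
  filter_upwards [ae_restrict_mem measurableSet_Ioi] with r hr
  rw [Real.norm_of_nonneg (excessIntegrand_nonneg hlam hz hr)]
  exact excessIntegrand_le hlam hβ hz hr (by norm_num) (by norm_num)

lemma integrableOn_muIntegrand {lam β z : ℝ} (hlam : 0 < lam) (hβ : 2 < β) (hz : 0 < z)
    (u : ℝ) : IntegrableOn (muIntegrand lam β z u) (Ioi 0) :=
  IntegrableOn.congr_fun (((integrableOn_excessIntegrand hlam hβ hz u).add
    (integrableOn_mul_exp_neg_mul_sq (mul_pos Real.pi_pos hlam) 0)).const_mul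
      (2 * (Real.pi * lam))⁻¹)
    (fun _ hr => (muIntegrand_eq hlam.ne' (by linarith) hz hr).symm) measurableSet_Ioi

lemma mu_sub_one {lam β z : ℝ} (hlam : 0 < lam) (hβ : 2 < β) (hz : 0 < z) (u : ℝ) :
    mu lam β z u - 1 = ∫ r in Ioi 0, excessIntegrand lam β z u r := by
  have hc : 0 < Real.pi * lam := mul_pos Real.pi_pos hlam
  rw [mu, setIntegral_congr_fun measurableSet_Ioi
    (fun r hr => muIntegrand_eq hlam.ne' (by linarith) hz hr), integral_const_mul,
    integral_add (integrableOn_excessIntegrand hlam hβ hz u) (integrableOn_mul_exp_neg_mul_sq hc 0),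
    integral_Ioi_mul_exp_neg_mul_sq hc]
  have := hc.ne'
  have hl := hlam.ne'
  simp
  field_simp
  ring

lemma mu_sub_one_nonneg {lam β z : ℝ} (hlam : 0 < lam) (hβ : 2 < β) (hz : 0 < z) (u : ℝ) :
    0 ≤ mu lam β z u - 1 := by
  rw [mu_sub_one hlam hβ hz]
  exact setIntegral_nonneg measurableSet_Ioi fun r hr => excessIntegrand_nonneg hlam hz hr

lemma mu_sub_one_le {lam β z θ : ℝ} (hlam : 0 < lam) (hβ : 2 < β) (hz : 0 < z) (u : ℝ)
    (hθ : 0 < θ) (hθ1 : θ ≤ 1) :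
    mu lam β z u - 1 ≤ lam * ((∫ v, kernel β 1 v) * z ^ (2 / β)) / θ *
        Real.exp (lam * θ * ((∫ v, kernel β 1 v) * z ^ (2 / β))) := by
  have hc : 0 < Real.pi * lam * θ := by have := Real.pi_pos; positivity
  rw [mu_sub_one hlam hβ hz]
  refine (setIntegral_mono_on (integrableOn_excessIntegrand hlam hβ hz u)
    ((integrableOn_mul_exp_neg_mul_sq hc 0).const_mul _) measurableSet_Ioi
    fun r hr => excessIntegrand_le hlam hβ hz hr hθ hθ1).trans_eq ?_
  rw [integral_const_mul, integral_Ioi_mul_exp_neg_mul_sq hc]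
  simp

/-! ### Absolute convergence of τ -/

lemma K_pos {β : ℝ} (hβ : 2 < β) : 0 < K β := by
  have hpi := Real.pi_pos
  have : 0 < Real.sin (2 * Real.pi / β) := by
    apply Real.sin_pos_of_pos_of_lt_pi (by positivity)
    rw [div_lt_iff₀ (by linarith)]
    nlinarith
  unfold K; positivity

lemma tauIntegrand_nonneg {lam β z : ℝ} (hlam : 0 < lam) (hβ : 2 < β) (hz : 0 < z)
    (sigmaSq u : ℝ) : 0 ≤ tauIntegrand lam β sigmaSq u z :=
  mul_nonneg (by positivity) (mu_sub_one_nonneg hlam hβ hz u)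

lemma integrableOn_tauIntegrand {lam β : ℝ} (hlam : 0 < lam) (hβ : 2 < β) (u : ℝ) :
    IntegrableOn (tauIntegrand lam β 0 u) (Ioi 0) := by
  have hpi := Real.pi_pos
  have hK := K_pos hβ
  have hC : 0 ≤ ∫ v, kernel β 1 v := integral_nonneg fun v => kernel_nonneg one_pos v
  set C := ∫ v, kernel β 1 v with hCdef
  -- With this θ the growth exp(λθC z^(2/β)) of μ - 1 uses at most half of the decay exp(-πλK
  -- z^(2/β)), so C need not be evaluated.
  obtain ⟨θ, hθ, hθ1, hθC⟩ : ∃ θ : ℝ, 0 < θ ∧ θ ≤ 1 ∧ θ * C ≤ Real.pi * K β / 2 := by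
    refine ⟨Real.pi * K β / (Real.pi * K β + 2 * C), by positivity, ?_, ?_⟩
    · rw [div_le_one (by positivity)]; linarith
    · rw [div_mul_eq_mul_div, div_le_div_iff₀ (by positivity) two_pos]
      nlinarith [mul_pos hpi hK]
  have hdom : IntegrableOn (fun z : ℝ => lam * C / θ *
      (z ^ (2 / β - 1) * Real.exp (-(Real.pi * lam * K β / 2) * z ^ (2 / β)))) (Ioi 0) :=
    (integrableOn_rpow_mul_exp_neg_mul_rpow (by have : 0 < 2 / β := by positivity
                                                linarith)
      (by positivity) (by positivity)).const_mul _
  have hm : AEStronglyMeasurable (tauIntegrand lam β 0 u) (volume.restrict (Ioi 0)) := by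
    have h1 : Measurable fun z => ∫ r in Ioi 0, excessIntegrand lam β z u r :=
      ((measurable_excessIntegrand lam β u).stronglyMeasurable.integral_prod_right'
        (ν := volume.restrict (Ioi 0))).measurable
    have h2 : Measurable fun z => 1 / z * Real.exp (-0 * z - Real.pi * lam * K β * z ^ (2 / β)) *
        ∫ r in Ioi 0, excessIntegrand lam β z u r := by fun_prop
    refine h2.aestronglyMeasurable.congr ?_
    filter_upwards [ae_restrict_mem measurableSet_Ioi] with z hz
    rw [tauIntegrand, mu_sub_one hlam hβ hz]
  refine hdom.mono' hm ?_
  filter_upwards [ae_restrict_mem measurableSet_Ioi] with z (hz : 0 < z)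
  rw [Real.norm_of_nonneg (tauIntegrand_nonneg hlam hβ hz 0 u), tauIntegrand]
  have ht : 0 < z ^ (2 / β) := by positivity
  calc _ ≤ 1 / z * Real.exp (-0 * z - Real.pi * lam * K β * z ^ (2 / β)) *
        (lam * (C * z ^ (2 / β)) / θ * Real.exp (lam * θ * (C * z ^ (2 / β)))) :=
        mul_le_mul_of_nonneg_left (mu_sub_one_le hlam hβ hz u hθ hθ1) (by positivity)
    _ = lam * C / θ * (z ^ (2 / β - 1) *
        Real.exp (lam * z ^ (2 / β) * (θ * C) - Real.pi * lam * K β * z ^ (2 / β))) := by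
        rw [Real.rpow_sub_one hz.ne',
          show lam * z ^ (2 / β) * (θ * C) - Real.pi * lam * K β * z ^ (2 / β)
            = (-0 * z - Real.pi * lam * K β * z ^ (2 / β)) + lam * θ * (C * z ^ (2 / β)) by ring,
          Real.exp_add]
        ring
    _ ≤ _ := by
        gcongr
        nlinarith [mul_le_mul_of_nonneg_left hθC (mul_pos hlam ht).le]

/-! ### Gaussian integrals and the first-order lower bound for μ - 1 -/

lemma integral_gaussian_complex {b : ℝ} (hb : 0 < b) (a : ℂ) :
    ∫ v : ℂ, Real.exp (-b * ‖v + a‖ ^ 2) = Real.pi / b := by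
  rw [integral_add_right_eq_self fun v : ℂ => Real.exp (-b * ‖v‖ ^ 2),
    GaussianFourier.integral_rexp_neg_mul_sq_norm hb]
  simp

/-- Complete the square: the product is a Gaussian centred at -u/(1+a), times a constant carrying
the residue u²a/(1+a). -/
lemma lintegral_gaussian_mul_gaussian {lam a : ℝ} (hlam : 0 < lam) (ha : 0 ≤ a) (u : ℝ) :
    ∫⁻ v : ℂ, ENNReal.ofReal (lam * Real.exp (-(Real.pi * lam) * ‖v + u‖ ^ 2)) *
        ENNReal.ofReal (Real.exp (-(Real.pi * lam) * a * ‖v‖ ^ 2))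
      = ENNReal.ofReal (1 / (1 + a) * Real.exp (-Real.pi * lam * u ^ 2 * (a / (1 + a)))) := by
  have hpi := Real.pi_pos
  have hb : 0 < Real.pi * lam * (1 + a) := by positivity
  have hI := integral_gaussian_complex hb ((u / (1 + a) : ℝ) : ℂ)
  have hint : Integrable fun v : ℂ =>
      Real.exp (-(Real.pi * lam * (1 + a)) * ‖v + ((u / (1 + a) : ℝ) : ℂ)‖ ^ 2) := by
    -- A non-integrable function has integral 0 by convention, but the value here is positive.
    by_contra h
    rw [integral_undef h] at hI
    exact (by positivity : 0 < Real.pi / (Real.pi * lam * (1 + a))).ne hI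
  have hsq : ∀ v : ℂ, ‖v + u‖ ^ 2 + a * ‖v‖ ^ 2
      = (1 + a) * ‖v + ((u / (1 + a) : ℝ) : ℂ)‖ ^ 2 + u ^ 2 * (a / (1 + a)) := by
    intro v
    simp only [Complex.sq_norm, Complex.normSq_apply, Complex.add_re, Complex.add_im,
      Complex.ofReal_re, Complex.ofReal_im]
    field_simp
    ring
  have hpt : ∀ v : ℂ, ENNReal.ofReal (lam * Real.exp (-(Real.pi * lam) * ‖v + u‖ ^ 2)) *
        ENNReal.ofReal (Real.exp (-(Real.pi * lam) * a * ‖v‖ ^ 2))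
      = ENNReal.ofReal (lam * Real.exp (-Real.pi * lam * u ^ 2 * (a / (1 + a))) *
        Real.exp (-(Real.pi * lam * (1 + a)) * ‖v + ((u / (1 + a) : ℝ) : ℂ)‖ ^ 2)) := by
    intro v
    rw [← ENNReal.ofReal_mul (by positivity), mul_assoc lam, mul_assoc lam, ← Real.exp_add,
      ← Real.exp_add]
    congr 3
    linear_combination (-(Real.pi * lam)) * hsq v
  simp_rw [hpt]
  rw [← ofReal_integral_eq_lintegral_ofReal (hint.const_mul _)
    (ae_of_all _ fun v => by simp only [Pi.zero_apply]; positivity), integral_const_mul, hI]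
  congr 1
  field_simp

/-- Bounding `exp (λ J) - 1` below by `λ J` and integrating out the distance `r`. -/
lemma lintegral_gaussian_mul_kernel_le {lam β z : ℝ} (hlam : 0 < lam) (hβ : 2 < β) (hz : 0 < z)
    (u : ℝ) :
    ∫⁻ v : ℂ, ENNReal.ofReal (lam * Real.exp (-(Real.pi * lam) * ‖v + u‖ ^ 2)) *
        ENNReal.ofReal (kernel β z v) ≤ ENNReal.ofReal (mu lam β z u - 1) := by
  have hpi := Real.pi_pos
  have hc : 0 < Real.pi * lam := by positivity
  have hkm : Measurable (kernel β z) := (continuous_kernel (by linarith) hz).measurable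
  set G : ℝ → ENNReal := fun r =>
    ENNReal.ofReal (2 * (Real.pi * lam) * r * Real.exp (-(Real.pi * lam) * r ^ 2)) with hG
  have hGm : Measurable G := by fun_prop
  rw [mu_sub_one hlam hβ hz, ofReal_integral_eq_lintegral_ofReal
    (integrableOn_excessIntegrand hlam hβ hz u) (by
      filter_upwards [ae_restrict_mem measurableSet_Ioi] with r hr
      exact excessIntegrand_nonneg hlam hz hr)]
  set k : ℂ → ENNReal := fun v => ENNReal.ofReal lam * ENNReal.ofReal (kernel β z (v - u)) with hk
  have hkm' : Measurable k := by fun_prop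
  calc ∫⁻ v : ℂ, ENNReal.ofReal (lam * Real.exp (-(Real.pi * lam) * ‖v + u‖ ^ 2)) *
        ENNReal.ofReal (kernel β z v)
      = ∫⁻ v : ℂ, ENNReal.ofReal (lam * Real.exp (-(Real.pi * lam) * ‖v‖ ^ 2)) *
        ENNReal.ofReal (kernel β z (v - u)) := by
        rw [← lintegral_add_right_eq_self (fun v : ℂ =>
          ENNReal.ofReal (lam * Real.exp (-(Real.pi * lam) * ‖v‖ ^ 2)) *
            ENNReal.ofReal (kernel β z (v - u))) (u : ℂ)]
        simp
    -- The Gaussian at v is the tail over r > |v| of the radial density; swapping then restricts v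
    -- to the disc of radius r.
    _ = ∫⁻ v : ℂ, ∫⁻ r in Ioi (0 : ℝ), (Ioi ‖v‖).indicator (fun r => G r * k v) r := by
        refine lintegral_congr fun v => ?_
        rw [setLIntegral_indicator measurableSet_Ioi,
          inter_eq_self_of_subset_left (Ioi_subset_Ioi (norm_nonneg v)),
          lintegral_mul_const _ hGm, lintegral_Ioi_mul_exp_neg_mul_sq hc (norm_nonneg v),
          ENNReal.ofReal_mul hlam.le, hk]
        ring
    _ = ∫⁻ r in Ioi (0 : ℝ), ∫⁻ v : ℂ, (Ioi ‖v‖).indicator (fun r => G r * k v) r := by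
        refine lintegral_lintegral_swap (Measurable.aemeasurable ?_)
        have : Measurable fun p : ℂ × ℝ =>
            {p : ℂ × ℝ | ‖p.1‖ < p.2}.indicator (fun p => G p.2 * k p.1) p :=
          Measurable.indicator (by fun_prop) (measurableSet_lt (by fun_prop) (by fun_prop))
        convert this using 1
        ext p
        simp [Function.uncurry, indicator]
    _ ≤ _ := by
        refine setLIntegral_mono' measurableSet_Ioi fun r (hr : 0 < r) => ?_
        have hind : ∀ v : ℂ, (Ioi ‖v‖).indicator (fun r => G r * k v) r
            = (Metric.ball (0 : ℂ) r).indicator (fun v => G r * k v) v := by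
          intro v; simp [indicator]
        simp_rw [hind]
        rw [lintegral_indicator measurableSet_ball, lintegral_const_mul _ hkm',
          lintegral_const_mul _ (by fun_prop), ← ofReal_discIntegral hβ hz,
          ← ENNReal.ofReal_mul hlam.le, ← ENNReal.ofReal_mul (by positivity)]
        exact ENNReal.ofReal_le_ofReal (le_excessIntegrand hlam hr)

/-! ### The two substitutions and the comparison with τ -/

lemma lintegral_Ioi_substitution {f f' : ℝ → ℝ} (hf : BijOn f (Ioi 0) (Ioi 0))
    (hf' : ∀ x ∈ Ioi (0 : ℝ), HasDerivAt f (f' x) x) (hpos : ∀ x ∈ Ioi (0 : ℝ), 0 ≤ f' x)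
    (g : ℝ → ENNReal) :
    ∫⁻ y in Ioi 0, g y = ∫⁻ x in Ioi 0, ENNReal.ofReal (f' x) * g (f x) := by
  rw [← hf.image_eq, lintegral_image_eq_lintegral_abs_deriv_mul measurableSet_Ioi
    (fun x hx => (hf' x hx).hasDerivWithinAt) hf.injOn, hf.image_eq]
  exact setLIntegral_congr_fun measurableSet_Ioi fun x hx => by rw [abs_of_nonneg (hpos x hx)]

/-- Substituting z = ρ^β s cancels ρ^β from the denominator and makes the exponent quadratic in ρ,
hence Gaussian when ρ = |v|. -/
lemma lintegral_exp_div_add_rpow {β ρ : ℝ} (c : ℝ) (hβ : 0 < β) (hρ : 0 < ρ) :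
    ∫⁻ z in Ioi 0, ENNReal.ofReal (Real.exp (-c * z ^ (2 / β)) / (z + ρ ^ β))
      = ∫⁻ s in Ioi 0, ENNReal.ofReal (Real.exp (-c * s ^ (2 / β) * ρ ^ 2) / (1 + s)) := by
  have hR : 0 < ρ ^ β := by positivity
  have hbij : BijOn (fun s => ρ ^ β * s) (Ioi 0) (Ioi 0) := by
    refine ⟨fun s (hs : 0 < s) => mul_pos hR hs, (mul_right_injective₀ hR.ne').injOn,
      fun y (hy : 0 < y) => ⟨y / ρ ^ β, div_pos hy hR, ?_⟩⟩
    simp only; field_simp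
  rw [lintegral_Ioi_substitution hbij
    (fun s _ => by simpa using (hasDerivAt_id s).const_mul (ρ ^ β)) fun _ _ => hR.le]
  refine setLIntegral_congr_fun measurableSet_Ioi fun s (hs : 0 < s) => ?_
  rw [← ENNReal.ofReal_mul hR.le, Real.mul_rpow hR.le hs.le, ← Real.rpow_mul hρ.le,
    mul_div_cancel₀ _ hβ.ne', Real.rpow_ofNat]
  congr 1
  rw [show -c * (ρ ^ 2 * s ^ (2 / β)) = -c * s ^ (2 / β) * ρ ^ 2 by ring]
  field_simp
  ring

/-- The new variable is the Gaussian parameter y = K s^(2/β), that is s = (y/K)^(β/2). -/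
lemma lintegral_lowerIntegrand {β : ℝ} (lam : ℝ) (hβ : 2 < β) (u : ℝ) :
    ∫⁻ s in Ioi 0, ENNReal.ofReal (1 / (1 + s)) * ENNReal.ofReal (1 / (1 + K β * s ^ (2 / β)) *
        Real.exp (-Real.pi * lam * u ^ 2 * (K β * s ^ (2 / β) / (1 + K β * s ^ (2 / β)))))
      = ∫⁻ y in Ioi 0, ENNReal.ofReal (β / 2 * lowerIntegrand lam β u y) := by
  have hK := K_pos hβ
  have hβ0 : 0 < β := by linarith
  have hinv : ∀ x : ℝ, 0 ≤ x → (x ^ (β / 2)) ^ (2 / β) = x := fun x hx => by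
    rw [← Real.rpow_mul hx, show β / 2 * (2 / β) = 1 by field_simp, Real.rpow_one]
  have hinv' : ∀ x : ℝ, 0 ≤ x → (x ^ (2 / β)) ^ (β / 2) = x := fun x hx => by
    rw [← Real.rpow_mul hx, show 2 / β * (β / 2) = 1 by field_simp, Real.rpow_one]
  have hbij : BijOn (fun y => (y / K β) ^ (β / 2)) (Ioi 0) (Ioi 0) := by
    refine ⟨fun y (hy : 0 < y) => by simp only [mem_Ioi]; positivity,
      fun x (hx : 0 < x) y (hy : 0 < y) h => ?_,
      fun s (hs : 0 < s) => ⟨K β * s ^ (2 / β), by simp only [mem_Ioi]; positivity, ?_⟩⟩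
    · have := congrArg (· ^ (2 / β)) h
      simp only at this
      rw [hinv _ (by positivity), hinv _ (by positivity)] at this
      field_simp at this
      exact this
    · simp only
      rw [mul_div_cancel_left₀ _ hK.ne', hinv' s hs.le]
  have hd : ∀ y ∈ Ioi (0 : ℝ), HasDerivAt (fun y => (y / K β) ^ (β / 2))
      (1 / K β * (β / 2) * (y / K β) ^ (β / 2 - 1)) y := fun y (hy : 0 < y) =>
    ((hasDerivAt_id y).div_const (K β)).rpow_const (Or.inl (div_pos hy hK).ne')
  rw [lintegral_Ioi_substitution hbij hd fun y (hy : 0 < y) => by positivity]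
  refine setLIntegral_congr_fun measurableSet_Ioi fun y (hy : 0 < y) => ?_
  rw [hinv _ (by positivity), mul_div_cancel₀ _ hK.ne', ← ENNReal.ofReal_mul (by positivity),
    ← ENNReal.ofReal_mul (by positivity), lowerIntegrand, Real.rpow_sub_one (by positivity),
    Real.rpow_sub_one hy.ne', Real.div_rpow hy.le hK.le]
  congr 1
  have h1 : 0 < y ^ (β / 2) := by positivity
  have h2 : 0 < K β ^ (β / 2) := by positivity
  field_simp

lemma lintegral_lowerIntegrand_le_tau {lam β : ℝ} (hlam : 0 < lam) (hβ : 2 < β) (u : ℝ) :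
    ∫⁻ y in Ioi 0, ENNReal.ofReal (β / 2 * lowerIntegrand lam β u y)
      ≤ ENNReal.ofReal (tau lam β 0 u) := by
  have hpi := Real.pi_pos
  have hK := K_pos hβ
  have hβ0 : 0 < β := by linarith
  set c := Real.pi * lam * K β with hc
  set g : ℂ → ENNReal := fun v =>
    ENNReal.ofReal (lam * Real.exp (-(Real.pi * lam) * ‖v + u‖ ^ 2)) with hg
  have hgm : Measurable g := by fun_prop
  rw [tau, ofReal_integral_eq_lintegral_ofReal (integrableOn_tauIntegrand hlam hβ u) (by
    filter_upwards [ae_restrict_mem measurableSet_Ioi] with z hz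
    exact tauIntegrand_nonneg hlam hβ hz 0 u), ← lintegral_lowerIntegrand lam hβ u]
  calc _ = ∫⁻ s in Ioi (0 : ℝ), ∫⁻ v : ℂ,
        g v * ENNReal.ofReal (Real.exp (-c * s ^ (2 / β) * ‖v‖ ^ 2) / (1 + s)) := by
        refine setLIntegral_congr_fun measurableSet_Ioi fun s (hs : 0 < s) => ?_
        rw [← lintegral_gaussian_mul_gaussian hlam (by positivity), ← lintegral_const_mul _ (by fun_prop)]
        refine lintegral_congr fun v => ?_
        rw [div_eq_mul_one_div (Real.exp _), ENNReal.ofReal_mul (Real.exp_nonneg _),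
          show -(Real.pi * lam) * (K β * s ^ (2 / β)) * ‖v‖ ^ 2 = -c * s ^ (2 / β) * ‖v‖ ^ 2 by
            rw [hc]; ring, hg]
        ring
    _ = ∫⁻ v : ℂ, ∫⁻ s in Ioi (0 : ℝ),
        g v * ENNReal.ofReal (Real.exp (-c * s ^ (2 / β) * ‖v‖ ^ 2) / (1 + s)) :=
        lintegral_lintegral_swap (Measurable.aemeasurable (by fun_prop))
    _ = ∫⁻ v : ℂ, ∫⁻ z in Ioi (0 : ℝ),
        g v * ENNReal.ofReal (Real.exp (-c * z ^ (2 / β)) / (z + ‖v‖ ^ β)) := by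
        refine lintegral_congr_ae ?_
        -- The scaling z = |v|^β s degenerates at v = 0, a null set.
        filter_upwards [compl_mem_ae_iff.mpr (measure_singleton (0 : ℂ))] with v hv
        rw [lintegral_const_mul _ (by fun_prop), lintegral_const_mul _ (by fun_prop),
          lintegral_exp_div_add_rpow c hβ0 (norm_pos_iff.mpr hv)]
    _ = ∫⁻ z in Ioi (0 : ℝ), ∫⁻ v : ℂ,
        g v * ENNReal.ofReal (Real.exp (-c * z ^ (2 / β)) / (z + ‖v‖ ^ β)) :=
        lintegral_lintegral_swap (Measurable.aemeasurable (by fun_prop))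
    _ ≤ _ := by
        refine setLIntegral_mono' measurableSet_Ioi fun z (hz : 0 < z) => ?_
        have hkm : Measurable (kernel β z) := (continuous_kernel hβ0 hz).measurable
        have hpt : ∀ v : ℂ, g v * ENNReal.ofReal (Real.exp (-c * z ^ (2 / β)) / (z + ‖v‖ ^ β))
            = ENNReal.ofReal (1 / z * Real.exp (-0 * z - c * z ^ (2 / β))) *
              (g v * ENNReal.ofReal (kernel β z v)) := by
          intro v
          have hden : 0 < z + ‖v‖ ^ β := by positivity
          rw [mul_left_comm, kernel, ← ENNReal.ofReal_mul
            (by positivity : 0 ≤ 1 / z * Real.exp (-0 * z - c * z ^ (2 / β)))]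
          congr 2
          rw [show -0 * z - c * z ^ (2 / β) = -c * z ^ (2 / β) by ring]
          field_simp
        simp_rw [hpt]
        rw [lintegral_const_mul _ (by fun_prop), tauIntegrand, ENNReal.ofReal_mul
          (by positivity : 0 ≤ 1 / z * Real.exp (-0 * z - Real.pi * lam * K β * z ^ (2 / β)))]
        exact mul_le_mul' le_rfl (lintegral_gaussian_mul_kernel_le hlam hβ hz u)

end HandoverSkipping

theorem corollary1 (lam β : ℝ) (hlam : 0 < lam) (hβ : 2 < β)
    (sigmaSq : ℝ) (hsigma : sigmaSq = 0) (u : ℝ) (hu : 0 ≤ u) :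
    (∀ z : ℝ, 0 < z → IntegrableOn (HandoverSkipping.muIntegrand lam β z u) (Ioi 0)) ∧
    IntegrableOn (HandoverSkipping.tauIntegrand lam β sigmaSq u) (Ioi 0) ∧
    IntegrableOn (HandoverSkipping.lowerIntegrand lam β u) (Ioi 0) ∧
    β / 2 * (∫ z in Ioi (0 : ℝ), HandoverSkipping.lowerIntegrand lam β u z)
      ≤ HandoverSkipping.tau lam β sigmaSq u := by
  subst hsigma
  have hle := HandoverSkipping.lintegral_lowerIntegrand_le_tau hlam hβ u
  have hK := HandoverSkipping.K_pos hβ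
  have hnn : 0 ≤ᵐ[volume.restrict (Ioi 0)]
      fun y => β / 2 * HandoverSkipping.lowerIntegrand lam β u y := by
    filter_upwards [ae_restrict_mem measurableSet_Ioi] with y (hy : 0 < y)
    simp only [Pi.zero_apply]
    unfold HandoverSkipping.lowerIntegrand
    positivity
  have hm : Measurable fun y => β / 2 * HandoverSkipping.lowerIntegrand lam β u y := by
    unfold HandoverSkipping.lowerIntegrand
    fun_prop
  -- Finiteness comes from the comparison itself: the nonnegative integral is at most the real
  -- number τ.
  have hint : IntegrableOn (fun y => β / 2 * HandoverSkipping.lowerIntegrand lam β u y) (Ioi 0) :=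
    ⟨hm.aestronglyMeasurable, (hasFiniteIntegral_iff_ofReal hnn).mpr
      (hle.trans_lt ENNReal.ofReal_lt_top)⟩
  refine ⟨fun z hz => HandoverSkipping.integrableOn_muIntegrand hlam hβ hz u,
    HandoverSkipping.integrableOn_tauIntegrand hlam hβ u, ?_, ?_⟩
  · exact (integrable_const_mul_iff (IsUnit.mk0 _ (by positivity)) _).mp hint
  · have hτ : 0 ≤ HandoverSkipping.tau lam β 0 u := setIntegral_nonneg measurableSet_Ioi
      fun z hz => HandoverSkipping.tauIntegrand_nonneg hlam hβ hz 0 u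
    rw [← integral_const_mul, ← ENNReal.ofReal_le_ofReal_iff hτ,
      ofReal_integral_eq_lintegral_ofReal hint hnn]
    exact hle
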